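/- Let $\mathcal{M}er(\mathbb{C})$ be the field of meromorphic functions on $\mathbb{C}$, with the derivation $\frac{d}{dx}$, and let $\mathbb{C}(x)\subset \mathcal{M}er(\mathbb{C})$ be the subfield of rational functions. Functions $f,g\in\mathcal{M}er(\mathbb{C})$ are called differentially independent over $\mathbb{C}(x)$ if the family of all their derivatives $\left(\frac{d^i f}{dx^i}\right)_{i\ge 0},\left(\frac{d^j g}{dx^j}\right)_{j\ge 0}$ is algebraically independent over $\mathbb{C}(x)$, i.e. no nonzero differential polynomial in two unknown functions with coefficients in $\mathbb{C}(x)$ vanishes at $(f,g)$. Let $\zeta$ be the Riemann zeta function (meromorphically continued to $\mathbb{C}$) and $\Gamma$ the Euler Gamma function. Then the meromorphic functions $x\mapsto \zeta(\sin(2\pi x))$ and $x\mapsto\Gamma(x)$ are differentially independent over $\mathbb{C}(x)$. Likewise, the meromorphic functions $x\mapsto \Gamma(\sin(2\pi x))$ and $x\mapsto\Gamma(x)$ are differentially independent over $\mathbb{C}(x)$. -/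

import Mathlib

/-- A family `f` of elements of a differential ring `A` is differentially independent over the
coefficient ring `k` when the family of all the iterated derivatives `f i, (f i)′, (f i)″, …`
is algebraically independent over `k`: no nonzero differential polynomial with coefficients
in `k` vanishes at `f`. -/
def DifferentiallyIndependent (k : Type*) {A ι : Type*} [CommRing k] [CommRing A] [Algebra k A]
    [Differential A] (f : ι → A) : Prop :=
  AlgebraicIndependent k (fun p : ι × ℕ => (Differential.deriv : A → A)^[p.2] (f p.1))

namespace Mer

open Filter Topology

theorem meromorphic_const (c : ℂ) : Meromorphic (fun _ : ℂ => c) :=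
  fun x => MeromorphicAt.const c x

theorem meromorphic_zero : Meromorphic (0 : ℂ → ℂ) := meromorphic_const 0

theorem meromorphic_one : Meromorphic (1 : ℂ → ℂ) := meromorphic_const 1

theorem meromorphic_id : Meromorphic (fun x : ℂ => x) := fun x => MeromorphicAt.id x

theorem eventually_codiscrete_iff {P : ℂ → Prop} :
    (∀ᶠ z in codiscrete ℂ, P z) ↔ ∀ x, ∀ᶠ z in 𝓝[≠] x, P z := by
  change {z | P z} ∈ codiscreteWithin Set.univ ↔ _
  rw [mem_codiscreteWithin_iff_forall_mem_nhdsNE]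
  simp [Filter.Eventually]

theorem eventually_analyticAt {f : ℂ → ℂ} (hf : Meromorphic f) :
    ∀ᶠ z in codiscrete ℂ, AnalyticAt ℂ f z :=
  eventually_codiscrete_iff.2 fun x => (hf x).eventually_analyticAt

theorem eventually_deriv_eq {f g : ℂ → ℂ} (h : f =ᶠ[codiscrete ℂ] g) :
    deriv f =ᶠ[codiscrete ℂ] deriv g :=
  eventually_codiscrete_iff.2 fun x =>
    EventuallyEq.nhdsNE_deriv (eventually_codiscrete_iff.1 h x)

/-- The ring of meromorphic functions on `ℂ`, two such functions being identified when they
agree off a closed discrete set (so that values at poles are irrelevant). -/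
def merSubring : Subring (Germ (codiscrete ℂ) ℂ) where
  carrier := {g | ∃ f : ℂ → ℂ, Meromorphic f ∧ (f : Germ (codiscrete ℂ) ℂ) = g}
  zero_mem' := ⟨0, meromorphic_zero, rfl⟩
  one_mem' := ⟨1, meromorphic_one, rfl⟩
  add_mem' := by
    rintro _ _ ⟨f, hf, rfl⟩ ⟨g, hg, rfl⟩
    exact ⟨f + g, hf.add hg, rfl⟩
  mul_mem' := by
    rintro _ _ ⟨f, hf, rfl⟩ ⟨g, hg, rfl⟩
    exact ⟨f * g, hf.mul hg, rfl⟩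
  neg_mem' := by
    rintro _ ⟨f, hf, rfl⟩
    exact ⟨-f, hf.neg, rfl⟩

end Mer

/-- The field `Mer(ℂ)` of meromorphic functions on `ℂ`. -/
abbrev Mer : Type := ↥Mer.merSubring

namespace Mer

open Filter Topology

/-- The element of `Mer(ℂ)` given by a meromorphic function. -/
noncomputable def mk (f : ℂ → ℂ) (hf : Meromorphic f) : Mer := ⟨(f : Germ (codiscrete ℂ) ℂ), f, hf, rfl⟩

theorem ind {P : Mer → Prop} (h : ∀ f hf, P (mk f hf)) (a : Mer) : P a := by
  obtain ⟨_, f, hf, rfl⟩ := a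
  exact h f hf

theorem mk_eq_mk {f g : ℂ → ℂ} {hf : Meromorphic f} {hg : Meromorphic g} :
    mk f hf = mk g hg ↔ f =ᶠ[codiscrete ℂ] g :=
  Subtype.ext_iff.trans Germ.coe_eq

theorem mk_add {f g : ℂ → ℂ} (hf : Meromorphic f) (hg : Meromorphic g) :
    mk f hf + mk g hg = mk (f + g) (hf.add hg) := rfl

theorem mk_mul {f g : ℂ → ℂ} (hf : Meromorphic f) (hg : Meromorphic g) :
    mk f hf * mk g hg = mk (f * g) (hf.mul hg) := rfl

theorem mk_zero : mk 0 meromorphic_zero = 0 := rfl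

theorem mk_one : mk 1 meromorphic_one = 1 := rfl

/-- A meromorphic function on `ℂ` vanishes off a closed discrete set, or is nonzero off a closed
discrete set. -/
theorem eventually_eq_zero_or_ne_zero {f : ℂ → ℂ} (hf : Meromorphic f) :
    (∀ᶠ z in codiscrete ℂ, f z = 0) ∨ (∀ᶠ z in codiscrete ℂ, f z ≠ 0) := by
  by_cases h : ∃ x, meromorphicOrderAt f x ≠ ⊤
  · right
    rw [hf.exists_meromorphicOrderAt_ne_top_iff_forall] at h
    exact eventually_codiscrete_iff.2 fun x =>
      (meromorphicOrderAt_ne_top_iff_eventually_ne_zero (hf x)).1 (h x)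
  · left
    push Not at h
    exact eventually_codiscrete_iff.2 fun x => meromorphicOrderAt_eq_top_iff.1 (h x)

instance : Nontrivial Mer :=
  ⟨⟨0, 1, fun h => by
    have h1 := mk_eq_mk.1 (mk_zero.trans (h.trans mk_one.symm))
    obtain ⟨z, hz⟩ := (eventually_codiscrete_iff.1 h1 0).exists
    simp at hz⟩⟩

/-- Pointwise inverse. -/
noncomputable instance : Inv Mer :=
  ⟨fun a => ⟨(a : Germ (codiscrete ℂ) ℂ)⁻¹, by
    obtain ⟨_, f, hf, rfl⟩ := a
    exact ⟨f⁻¹, hf.inv, rfl⟩⟩⟩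

theorem mk_inv {f : ℂ → ℂ} (hf : Meromorphic f) : (mk f hf)⁻¹ = mk f⁻¹ hf.inv := rfl

noncomputable instance : Field Mer where
  __ := (inferInstance : CommRing Mer)
  __ := (inferInstance : Nontrivial Mer)
  inv := Inv.inv
  mul_inv_cancel := by
    refine ind fun f hf h0 => ?_
    refine (mk_eq_mk (hf := hf.mul hf.inv) (hg := meromorphic_one)).2 ?_
    rcases eventually_eq_zero_or_ne_zero hf with h | h
    · exact absurd ((mk_eq_mk (hf := hf) (hg := meromorphic_zero)).2 h) h0
    · exact h.mono fun z hz => mul_inv_cancel₀ hz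
  inv_zero := by
    exact (mk_eq_mk (hf := meromorphic_zero.inv) (hg := meromorphic_zero)).2
      (Eventually.of_forall fun z => inv_zero)
  nnqsmul := _
  nnqsmul_def := fun _ _ => rfl
  qsmul := _
  qsmul_def := fun _ _ => rfl

/-- Complex numbers as constant functions. -/
noncomputable instance : Algebra ℂ Mer :=
  RingHom.toAlgebra
    { toFun := fun c => mk (fun _ => c) (meromorphic_const c)
      map_one' := rfl
      map_mul' := fun _ _ => rfl
      map_zero' := rfl
      map_add' := fun _ _ => rfl }

/-- Differentiation of a meromorphic function, on underlying germs. -/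
noncomputable def derivFun (a : Mer) : Mer :=
  ⟨Germ.map' deriv (fun _ _ h => eventually_deriv_eq h) (a : Germ (codiscrete ℂ) ℂ), by
    obtain ⟨_, f, hf, rfl⟩ := a
    exact ⟨deriv f, hf.deriv, rfl⟩⟩

theorem derivFun_mk {f : ℂ → ℂ} (hf : Meromorphic f) :
    derivFun (mk f hf) = mk (deriv f) hf.deriv := rfl

theorem derivFun_add (a b : Mer) : derivFun (a + b) = derivFun a + derivFun b := by
  induction a using ind with | h f hf
  induction b using ind with | h g hg
  rw [mk_add, derivFun_mk, derivFun_mk, derivFun_mk, mk_add, mk_eq_mk]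
  filter_upwards [eventually_analyticAt hf, eventually_analyticAt hg] with z h1 h2
  exact deriv_add h1.differentiableAt h2.differentiableAt

theorem derivFun_mul (a b : Mer) : derivFun (a * b) = a * derivFun b + b * derivFun a := by
  induction a using ind with | h f hf
  induction b using ind with | h g hg
  simp only [mk_mul, mk_add, derivFun_mk]
  rw [mk_eq_mk]
  filter_upwards [eventually_analyticAt hf, eventually_analyticAt hg] with z h1 h2
  rw [deriv_mul h1.differentiableAt h2.differentiableAt]
  simp only [Pi.add_apply, Pi.mul_apply]
  ring

/-- `Mer(ℂ)` is a differential field with derivation `d/dx`. -/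
noncomputable instance : Differential Mer :=
  ⟨Derivation.mk' (AddMonoidHom.toIntLinearMap (AddMonoidHom.mk' derivFun derivFun_add))
    derivFun_mul⟩

theorem deriv_mk {f : ℂ → ℂ} (hf : Meromorphic f) :
    Differential.deriv (mk f hf) = mk (deriv f) hf.deriv := rfl

/-- The identity function `x`. -/
noncomputable def X : Mer := mk (fun x => x) meromorphic_id

/-- The subfield `ℂ(x)` of rational functions in `Mer(ℂ)`. -/
noncomputable abbrev rationalFunctions : IntermediateField ℂ Mer :=
  IntermediateField.adjoin ℂ {X}

theorem meromorphic_riemannZeta : Meromorphic riemannZeta := by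
  intro s
  by_cases hs : s = 1
  · subst hs
    have hd : ∀ᶠ z in 𝓝[≠] (1 : ℂ), DifferentiableAt ℂ
        (Function.update (fun s : ℂ => (s - 1) * riemannZeta s) 1 1) z := by
      filter_upwards [self_mem_nhdsWithin] with z hz
      have h1 : DifferentiableAt ℂ (fun s : ℂ => (s - 1) * riemannZeta s) z :=
        (by fun_prop : DifferentiableAt ℂ (fun s : ℂ => s - 1) z).mul
          (differentiableAt_riemannZeta hz)
      refine h1.congr_of_eventuallyEq ?_
      filter_upwards [isOpen_ne.mem_nhds hz] with w hw
      exact Function.update_of_ne hw _ _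
    have hc : ContinuousAt (Function.update (fun s : ℂ => (s - 1) * riemannZeta s) 1 1) 1 :=
      continuousAt_update_same.2 riemannZeta_residue_one
    have ha := Complex.analyticAt_of_differentiable_on_punctured_nhds_of_continuousAt hd hc
    have hm : MeromorphicAt (fun s : ℂ => (s - 1) * riemannZeta s) 1 := by
      refine ha.meromorphicAt.congr ?_
      filter_upwards [self_mem_nhdsWithin] with z hz
      exact Function.update_of_ne hz _ _
    have hi : MeromorphicAt (fun s : ℂ => (s - 1)⁻¹) 1 := by fun_prop
    refine (hi.mul hm).congr ?_
    filter_upwards [self_mem_nhdsWithin] with z hz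
    have : z - 1 ≠ 0 := sub_ne_zero.2 hz
    simp [this]
  · refine AnalyticAt.meromorphicAt ?_
    have : DifferentiableOn ℂ riemannZeta {1}ᶜ := fun z hz =>
      (differentiableAt_riemannZeta hz).differentiableWithinAt
    exact this.analyticAt (isOpen_compl_singleton.mem_nhds hs)

theorem meromorphic_comp_sin {f : ℂ → ℂ} (hf : Meromorphic f) :
    Meromorphic (fun x : ℂ => f (Complex.sin (2 * Real.pi * x))) := by
  intro x
  refine MeromorphicAt.comp_analyticAt (f := f)
    (g := fun x : ℂ => Complex.sin (2 * Real.pi * x)) (hf _) ?_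
  fun_prop

/-- The Gamma function, as a meromorphic function on `ℂ`. -/
noncomputable def Gamma : Mer := mk Complex.Gamma Meromorphic.Gamma

/-- The meromorphic function `x ↦ ζ(sin(2πx))`. -/
noncomputable def zetaSin : Mer :=
  mk (fun x : ℂ => riemannZeta (Complex.sin (2 * Real.pi * x)))
    (meromorphic_comp_sin meromorphic_riemannZeta)

/-- The meromorphic function `x ↦ Γ(sin(2πx))`. -/
noncomputable def gammaSin : Mer :=
  mk (fun x : ℂ => Complex.Gamma (Complex.sin (2 * Real.pi * x)))
    (meromorphic_comp_sin Meromorphic.Gamma)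

end Mer

/-!
The field `C` of meromorphic functions of period `1` is the field of constants of the shift
`σ : f(x) ↦ f(x + 1)`. The function `g(x) = F(sin 2πx)` and all its derivatives belong to `C`, so
the theorem splits into two statements about one function each
(`Mer.differentiallyIndependent_of_periodic`): the derivatives of the Gamma function, together with
`x`, are algebraically independent over `C`, and the derivatives of `g` are algebraically
independent over `ℂ`. Together they make `x`, the derivatives of `g` and those of `Γ` independent
over `ℂ`, and `x` then passes into the base field.

The first statement is Hölder's theorem with periodic coefficients. It is proved algebraically
(`algebraicIndependent_of_shift`), from `σ x = x + 1` and `σ Γ⁽ⁿ⁾ = x Γ⁽ⁿ⁾ + n Γ⁽ⁿ⁻¹⁾` alone.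
Among the relations in `C[X][Y 0, Y 1, …]` that have minimal degree for the lexicographic order,
take one, `P`, whose leading coefficient divides those of all the others; every relation of the
same degree is then a multiple of `P` by an element of `C[X]`
(`exists_forall_eq_C_mul_of_degree_le`). The shift of `P`, that is
`P(X + 1; X Y 0, X Y 1 + Y 0, …)`, is such a relation, hence equal to `q P`, and comparing
leading coefficients shows that `q` has positive degree: `P` is not constant in the `Y n`, because
`x` is transcendental over `C` (`Mer.transcendental_X`). Only `X` can be an irreducible factor of
`q`, since another one would give a common factor of the coefficients of `P`
(`exists_C_mul_of_C_dvd_shiftRel`). So `q(0) = 0`, whence `P(1; 0, Y 1, …) = 0`, by induction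
`P(k; 0, Y 1, …) = 0` for all `k ≥ 1`, and `Y 0` divides `P` (`X_zero_dvd_of_shiftRel_eq`), which
contradicts minimality.

For the second statement, an element is called differentially algebraic when it lies in a finitely
generated differential subfield, which is equivalent to the algebraic dependence of its
derivatives. This property passes to products and inverses, and it descends along composition with
`1 - x` and with `sin 2πx`, because these have differentially algebraic derivatives
(`IsDifferentiallyAlgebraic.of_map`). Hence it suffices that `F` is not differentially algebraic.
For `F = Γ` this is Hölder's theorem; for `F = ζ` it follows from it by the functional equation,
which expresses `Γ` through `ζ(x)`, `ζ(1 - x)`, an exponential and a cosine.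
-/

namespace Mer

open Filter Topology

/-! ### Composition of meromorphic functions with entire functions -/

/-- An element of `Mer(ℂ)` is nonzero as soon as a representative is continuous and nonzero at
some point. -/
theorem mk_ne_zero_of_continuousAt {f : ℂ → ℂ} (hf : Meromorphic f) {z : ℂ}
    (hc : ContinuousAt f z) (hz : f z ≠ 0) : mk f hf ≠ 0 := by
  intro h
  have h1 := eventually_codiscrete_iff.1 ((mk_eq_mk (hg := meromorphic_zero)).1 h) z
  have h2 : ∀ᶠ w in 𝓝[≠] z, f w ≠ 0 := (hc.eventually_ne hz).filter_mono nhdsWithin_le_nhds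
  obtain ⟨w, hw1, hw2⟩ := (h1.and h2).exists
  exact hw2 hw1

/-- The preimage of a closed discrete set under a nonconstant entire function is closed and
discrete. -/
theorem tendsto_codiscrete_of_differentiable {g : ℂ → ℂ} (hg : Differentiable ℂ g)
    (hne : ∃ a b, g a ≠ g b) : Tendsto g (codiscrete ℂ) (codiscrete ℂ) := by
  intro s hs
  refine eventually_codiscrete_iff.2 fun x => ?_
  have hx : ∀ᶠ z in 𝓝[≠] x, g z ≠ g x := by
    by_contra hcon
    have hfr : ∃ᶠ z in 𝓝[≠] x, g z = (fun _ => g x) z := by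
      rw [Filter.Frequently]; exact hcon
    have han : AnalyticOnNhd ℂ g Set.univ := fun z _ => hg.analyticAt z
    have heq := han.eq_of_frequently_eq (fun z _ => analyticAt_const) hfr
    obtain ⟨a, b, hab⟩ := hne
    exact hab (by rw [heq])
  have ht : Tendsto g (𝓝[≠] x) (𝓝[≠] (g x)) :=
    tendsto_nhdsWithin_iff.2 ⟨hg.continuous.continuousAt.mono_left nhdsWithin_le_nhds, hx⟩
  exact ht.eventually (eventually_codiscrete_iff.1 hs (g x))

/-- Composition `f ↦ f ∘ g` with a nonconstant entire function `g`, as an endomorphism of the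
`ℂ`-algebra `Mer(ℂ)`. -/
noncomputable def compHom (g : ℂ → ℂ) (hg : Differentiable ℂ g) (hne : ∃ a b, g a ≠ g b) :
    Mer →ₐ[ℂ] Mer where
  toFun a := ⟨(a : Germ (codiscrete ℂ) ℂ).compTendsto g
      (tendsto_codiscrete_of_differentiable hg hne), by
    obtain ⟨_, f, hf, rfl⟩ := a
    exact ⟨f ∘ g, fun x => (hf (g x)).comp_analyticAt (hg.analyticAt x), rfl⟩⟩
  map_one' := rfl
  map_mul' := by
    refine ind fun f hf => ind fun g hg => rfl
  map_zero' := rfl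
  map_add' := by
    refine ind fun f hf => ind fun g hg => rfl
  commutes' _ := rfl

theorem meromorphic_of_differentiable {g : ℂ → ℂ} (hg : Differentiable ℂ g) : Meromorphic g :=
  fun x => (hg.analyticAt x).meromorphicAt

/-- The chain rule. -/
theorem deriv_compHom {g : ℂ → ℂ} (hg : Differentiable ℂ g) (hne : ∃ a b, g a ≠ g b) (a : Mer) :
    Differential.deriv (compHom g hg hne a) = compHom g hg hne (Differential.deriv a) *
      Differential.deriv (mk g (meromorphic_of_differentiable hg)) := by
  induction a using ind with | h f hf
  refine (mk_eq_mk (f := deriv fun z => f (g z)) (g := fun z => deriv f (g z) * deriv g z)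
    (hf := Meromorphic.deriv fun x => (hf (g x)).comp_analyticAt (hg.analyticAt x))
    (hg := Meromorphic.mul (fun x => (hf.deriv (g x)).comp_analyticAt (hg.analyticAt x))
      (meromorphic_of_differentiable hg).deriv)).2 ?_
  filter_upwards [(tendsto_codiscrete_of_differentiable hg hne).eventually
    (eventually_analyticAt hf)] with z hz
  exact deriv_comp z hz.differentiableAt (hg z)

theorem deriv_algebraMap (c : ℂ) : Differential.deriv (algebraMap ℂ Mer c) = 0 := by
  change Differential.deriv (mk _ (meromorphic_const c)) = mk 0 meromorphic_zero
  rw [deriv_mk, mk_eq_mk]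
  exact Eventually.of_forall fun z => by simp

theorem deriv_X : Differential.deriv X = 1 := by
  rw [X, deriv_mk, ← mk_one, mk_eq_mk]
  exact Eventually.of_forall fun z => by simp

end Mer

/-! ### Differentially algebraic elements -/

/-- A finitely generated field has finite transcendence degree. -/
theorem not_algebraicIndependent_of_fg {k E : Type*} [Field k] [Field E] [Algebra k E]
    {L : IntermediateField k E} (hL : L.FG) {y : ℕ → E} (hy : ∀ n, y n ∈ L) :
    ¬ AlgebraicIndependent k y := by
  intro h
  have h1 : AlgebraicIndependent k (fun n => (⟨y n, hy n⟩ : L)) :=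
    AlgebraicIndependent.of_comp L.val h
  have : Algebra.EssFiniteType k L := IntermediateField.essFiniteType_iff.2 hL
  have h2 := h1.lift_cardinalMk_le_trdeg
  have h3 := _root_.trdeg_lt_aleph0 k L
  simp only [Cardinal.mk_nat, Cardinal.lift_aleph0, Cardinal.lift_uzero] at h2
  exact absurd h2 (not_le.2 h3)

section DifferentiallyAlgebraic
variable {k E : Type*} [Field k] [Field E] [Algebra k E] [Differential E]

open IntermediateField

/-- A derivation that maps generators into a larger subfield `M` maps the subfield they generate
over the constants into `M`. -/
theorem deriv_mem_adjoin (hk : ∀ c : k, Differential.deriv (algebraMap k E c) = 0) {S : Set E}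
    {M : IntermediateField k E} (hSM : S ⊆ M)
    (hS : ∀ s ∈ S, Differential.deriv s ∈ M) {a : E} (ha : a ∈ adjoin k S) :
    Differential.deriv a ∈ M := by
  have hle : adjoin k S ≤ M := adjoin_le_iff.2 hSM
  induction ha using adjoin_induction with
  | mem x hx => exact hS x hx
  | algebraMap c => rw [hk]; exact zero_mem _
  | add x y _ _ h1 h2 => rw [map_add]; exact add_mem h1 h2
  | inv x hx h =>
    rw [Derivation.leibniz_inv, smul_eq_mul]
    exact mul_mem (neg_mem (pow_mem (inv_mem (hle hx)) 2)) h
  | mul x y hx hy h1 h2 =>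
    rw [Derivation.leibniz, smul_eq_mul, smul_eq_mul]
    exact add_mem (mul_mem (hle hx) h2) (mul_mem (hle hy) h1)

/-- Differentiating the minimal equation of an algebraic element expresses its derivative
rationally. -/
theorem deriv_mem_of_isAlgebraic [CharZero k] {K M : IntermediateField k E} (hKM : K ≤ M)
    (hK : ∀ a ∈ K, Differential.deriv a ∈ M) {y : E} (hyM : y ∈ M) (hy : IsAlgebraic K y) :
    Differential.deriv y ∈ M := by
  have : CharZero K := charZero_of_injective_algebraMap (algebraMap k K).injective
  have hsep := (minpoly.irreducible hy.isIntegral).separable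
  have hne := hsep.aeval_derivative_ne_zero (minpoly.aeval K y)
  have hmem : ∀ p : Polynomial K, Polynomial.aeval y p ∈ M := fun p => by
    rw [Polynomial.aeval_eq_sum_range]
    exact sum_mem fun i _ => mul_mem (hKM (p.coeff i).2) (pow_mem hyM i)
  -- The difference is the value at `y` of `p` with differentiated coefficients.
  have key : ∀ p : Polynomial K, Differential.deriv (Polynomial.aeval y p) -
      Polynomial.aeval y p.derivative * Differential.deriv y ∈ M := by
    intro p
    induction p using Polynomial.induction_on' with
    | add p q hp hq =>
      simp only [map_add, add_mul]
      rw [add_sub_add_comm]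
      exact add_mem hp hq
    | monomial n c =>
      have : Differential.deriv (Polynomial.aeval y (Polynomial.monomial n c)) -
          Polynomial.aeval y (Polynomial.derivative (Polynomial.monomial n c)) *
            Differential.deriv y = y ^ n * Differential.deriv (c : E) := by
        simp only [Polynomial.aeval_monomial, Polynomial.derivative_monomial, Derivation.leibniz,
          Derivation.leibniz_pow, smul_eq_mul, nsmul_eq_mul, map_mul, map_natCast,
          IntermediateField.algebraMap_apply]
        ring
      rw [this]
      exact mul_mem (pow_mem hyM n) (hK _ c.2)
  have h0 := key (minpoly K y)
  rw [minpoly.aeval, map_zero, zero_sub, neg_mem_iff] at h0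
  rw [← mul_div_cancel_left₀ (Differential.deriv y) hne]
  exact div_mem h0 (hmem _)

/-- An element `f` of a differential field is differentially algebraic over the field `k` of
constants: it lies in a finitely generated differential subfield. When `k` consists of constants
and has characteristic zero, this means that the derivatives of `f` are algebraically dependent
over `k`; see `IsDifferentiallyAlgebraic.not_algebraicIndependent` and
`IsDifferentiallyAlgebraic.of_not_algebraicIndependent`. -/
def IsDifferentiallyAlgebraic (k : Type*) {E : Type*} [Field k] [Field E] [Algebra k E]
    [Differential E] (f : E) : Prop :=
  ∃ L : IntermediateField k E, L.FG ∧ (∀ a ∈ L, Differential.deriv a ∈ L) ∧ f ∈ L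

theorem iterate_deriv_mem {L : IntermediateField k E} (hL : ∀ a ∈ L, Differential.deriv a ∈ L)
    {f : E} (hf : f ∈ L) (n : ℕ) : (Differential.deriv : E → E)^[n] f ∈ L := by
  induction n with
  | zero => exact hf
  | succ n ih => rw [Function.iterate_succ_apply']; exact hL _ ih

namespace IsDifferentiallyAlgebraic

theorem not_algebraicIndependent {f : E} (h : IsDifferentiallyAlgebraic k f) :
    ¬ AlgebraicIndependent k (fun n => (Differential.deriv : E → E)^[n] f) := by
  obtain ⟨L, hL, hD, hf⟩ := h
  exact not_algebraicIndependent_of_fg hL (iterate_deriv_mem hD hf)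

/-- Two differentially algebraic elements lie in a common finitely generated differential subfield,
the compositum of the given ones. -/
theorem exists_common {f g : E} (hk : ∀ c : k, Differential.deriv (algebraMap k E c) = 0)
    (hf : IsDifferentiallyAlgebraic k f) (hg : IsDifferentiallyAlgebraic k g) :
    ∃ L : IntermediateField k E, L.FG ∧ (∀ a ∈ L, Differential.deriv a ∈ L) ∧ f ∈ L ∧ g ∈ L := by
  obtain ⟨L, hL, hD, hfL⟩ := hf
  obtain ⟨M, hM, hD', hgM⟩ := hg
  refine ⟨L ⊔ M, fg_sup hL hM, fun a ha => ?_, le_sup_left (a := L) hfL,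
    le_sup_right (a := L) hgM⟩
  have hsup : L ⊔ M = adjoin k ((L : Set E) ∪ M) := by
    rw [adjoin_union, adjoin_self, adjoin_self]
  rw [hsup] at ha
  refine deriv_mem_adjoin hk ?_ ?_ ha
  · exact Set.union_subset (le_sup_left (a := L)) (le_sup_right (a := L))
  · rintro s (hs | hs)
    · exact le_sup_left (a := L) (hD s hs)
    · exact le_sup_right (a := L) (hD' s hs)

theorem mul {f g : E} (hk : ∀ c : k, Differential.deriv (algebraMap k E c) = 0)
    (hf : IsDifferentiallyAlgebraic k f) (hg : IsDifferentiallyAlgebraic k g) :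
    IsDifferentiallyAlgebraic k (f * g) := by
  obtain ⟨L, hL, hD, h1, h2⟩ := hf.exists_common hk hg
  exact ⟨L, hL, hD, mul_mem h1 h2⟩

theorem inv {f : E} (hf : IsDifferentiallyAlgebraic k f) : IsDifferentiallyAlgebraic k f⁻¹ := by
  obtain ⟨L, hL, hD, h1⟩ := hf
  exact ⟨L, hL, hD, inv_mem h1⟩

theorem of_mem_finite {S : Set E} (hk : ∀ c : k, Differential.deriv (algebraMap k E c) = 0)
    (hfin : S.Finite) (hS : ∀ s ∈ S, Differential.deriv s ∈ adjoin k S) {f : E}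
    (hf : f ∈ adjoin k S) : IsDifferentiallyAlgebraic k f :=
  ⟨adjoin k S, fg_adjoin_of_finite hfin,
    fun _ ha => deriv_mem_adjoin hk (subset_adjoin k S) hS ha, hf⟩

/-- If the derivatives of `f` are algebraically dependent, some derivative is algebraic over
the preceding ones, and it closes up the field they generate under derivation. -/
theorem of_not_algebraicIndependent [CharZero k]
    (hk : ∀ c : k, Differential.deriv (algebraMap k E c) = 0) {f : E}
    (h : ¬ AlgebraicIndependent k (fun n => (Differential.deriv : E → E)^[n] f)) :
    IsDifferentiallyAlgebraic k f := by
  set y : ℕ → E := fun n => (Differential.deriv : E → E)^[n] f with hy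
  have hsucc : ∀ n, Differential.deriv (y n) = y (n + 1) := fun n =>
    (Function.iterate_succ_apply' _ _ _).symm
  obtain ⟨n, hn⟩ : ∃ n, IsAlgebraic (Algebra.adjoin k (y '' Set.Iio n)) (y n) := by
    by_contra! hcon
    have hI : ∀ n, AlgebraicIndepOn k y (Set.Iio n) := by
      intro n
      induction n with
      | zero =>
        have : IsEmpty (Set.Iio (0 : ℕ)) := by simp
        exact algebraicIndependent_empty_type
      | succ n ih =>
        have := ih.insert (hcon n)
        rwa [← Order.succ_eq_add_one, Order.Iio_succ_eq_insert]
    refine h (algebraicIndependent_of_finite_type fun t ht => ?_)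
    obtain ⟨b, hb⟩ := ht.bddAbove
    exact (hI (b + 1)).mono fun i hi => Nat.lt_succ_of_le (hb hi)
  set K := adjoin k (y '' Set.Iio n)
  set M := adjoin k (y '' Set.Iio (n + 1)) with hM
  have hmem : ∀ i < n + 1, y i ∈ M := fun i hi => subset_adjoin _ _ ⟨i, hi, rfl⟩
  have hKM : K ≤ M := adjoin.mono _ _ _ (Set.image_mono (Set.Iio_subset_Iio n.le_succ))
  have hK : ∀ a ∈ K, Differential.deriv a ∈ M := fun a ha => by
    refine deriv_mem_adjoin hk ((subset_adjoin _ _).trans hKM) ?_ ha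
    rintro _ ⟨i, hi, rfl⟩
    rw [hsucc]
    exact hmem _ (Nat.succ_lt_succ hi)
  have hyn : IsAlgebraic K (y n) := IsAlgebraic.tower_top_of_subalgebra_le
    (B := K.toSubalgebra) (algebra_adjoin_le_adjoin k _) hn
  have hlast := deriv_mem_of_isAlgebraic hKM hK (hmem n n.lt_succ_self) hyn
  refine of_mem_finite hk ((Set.finite_Iio (n + 1)).image y) ?_ (hmem 0 n.succ_pos)
  rintro _ ⟨i, hi, rfl⟩
  rcases (Nat.lt_succ_iff.1 hi).eq_or_lt with rfl | hlt
  · exact hlast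
  · rw [hsucc]
    exact hmem _ (Nat.succ_lt_succ hlt)

/-- Differential algebraicity descends along an endomorphism `φ` that satisfies a chain rule
`(φ f)′ = φ (f′) * w` (composition with a function whose derivative is `w`), provided the factor
`w` is itself differentially algebraic. -/
theorem of_map [CharZero k] (hk : ∀ c : k, Differential.deriv (algebraMap k E c) = 0)
    (φ : E →ₐ[k] E) {w : E} (hw0 : w ≠ 0)
    (hφ : ∀ a, Differential.deriv (φ a) = φ (Differential.deriv a) * w)
    (hw : IsDifferentiallyAlgebraic k w) {f : E} (hf : IsDifferentiallyAlgebraic k (φ f)) :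
    IsDifferentiallyAlgebraic k f := by
  obtain ⟨L, hL, hD, hfL, hwL⟩ := hf.exists_common hk hw
  refine of_not_algebraicIndependent hk fun h => ?_
  have hmem : ∀ n, φ ((Differential.deriv : E → E)^[n] f) ∈ L := by
    intro n
    induction n with
    | zero => exact hfL
    | succ n ih =>
      rw [Function.iterate_succ_apply', ← mul_div_cancel_right₀ (φ _) hw0, ← hφ]
      exact div_mem (hD _ ih) hwL
  exact not_algebraicIndependent_of_fg hL hmem (h.map' φ.injective)

end IsDifferentiallyAlgebraic
end DifferentiallyAlgebraic

/-! ### Triangular substitutions and monomial orders -/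

section LeadingTerm

open MvPolynomial
open scoped MonomialOrder
variable {ι R : Type*} [CommRing R] [IsDomain R] (mo : MonomialOrder ι) {r : R}
  {g : ι → MvPolynomial ι R}

theorem degree_C_mul_X_add (hr : r ≠ 0) (hg : ∀ i, mo.degree (g i) ≺[mo] Finsupp.single i 1)
    (i : ι) : mo.degree (C r * X i + g i) = Finsupp.single i 1 ∧
      mo.leadingCoeff (C r * X i + g i) = r := by
  have h1 : mo.degree (C r * X i : MvPolynomial ι R) = Finsupp.single i 1 := by
    rw [mo.degree_mul (by simpa using hr) (X_ne_zero i), mo.degree_C, mo.degree_X, zero_add]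
  have hlt : mo.degree (g i) ≺[mo] mo.degree (C r * X i : MvPolynomial ι R) := by
    rw [h1]; exact hg i
  rw [mo.degree_add_of_lt hlt, mo.leadingCoeff_add_of_lt hlt, h1]
  refine ⟨rfl, ?_⟩
  rw [MonomialOrder.leadingCoeff, h1, coeff_C_mul]
  simp

theorem degree_aeval_monomial (hr : r ≠ 0)
    (hg : ∀ i, mo.degree (g i) ≺[mo] Finsupp.single i 1) (d : ι →₀ ℕ) :
    mo.degree (aeval (fun i => C r * X i + g i) (monomial d (1 : R))) = d ∧
      mo.leadingCoeff (aeval (fun i => C r * X i + g i) (monomial d (1 : R))) =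
        r ^ d.degree := by
  have hb := degree_C_mul_X_add mo hr hg
  have hne : ∀ i, C r * X i + g i ≠ 0 := fun i => by
    rw [← mo.leadingCoeff_ne_zero_iff, (hb i).2]; exact hr
  rw [aeval_monomial, map_one, one_mul, Finsupp.prod]
  constructor
  · rw [mo.degree_prod fun i _ => pow_ne_zero _ (hne i)]
    simp_rw [mo.degree_pow, (hb _).1]
    conv_rhs => rw [← d.sum_single]
    simp [Finsupp.sum]
  · rw [mo.leadingCoeff_prod_of_regular fun i _ => ?_]
    · simp_rw [mo.leadingCoeff_pow, (hb _).2]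
      rw [Finset.prod_pow_eq_pow_sum, Finsupp.degree]
      rfl
    · rw [mo.leadingCoeff_pow, (hb i).2]
      exact IsRegular.of_ne_zero (pow_ne_zero _ hr)

/-- A triangular substitution `X i ↦ r X i + g i`, with `g i` of smaller degree than `X i`,
preserves the degree for a monomial order. -/
theorem degree_aeval_triangular (hr : r ≠ 0)
    (hg : ∀ i, mo.degree (g i) ≺[mo] Finsupp.single i 1) {P : MvPolynomial ι R} (hP : P ≠ 0) :
    mo.degree (aeval (fun i => C r * X i + g i) P) = mo.degree P ∧
      mo.leadingCoeff (aeval (fun i => C r * X i + g i) P) =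
        mo.leadingCoeff P * r ^ (mo.degree P).degree := by
  set T := aeval (R := R) (fun i => C r * X i + g i) with hT
  have hm := degree_aeval_monomial mo hr hg
  have hsum : T P = ∑ d ∈ P.support, C (P.coeff d) * T (monomial d 1) := by
    conv_lhs => rw [P.as_sum, map_sum]
    refine Finset.sum_congr rfl fun d _ => ?_
    rw [← mul_one (coeff d P), ← C_mul_monomial, map_mul, mul_one]
    simp [hT, algebraMap_eq]
  have hcoeff : (T P).coeff (mo.degree P) = mo.leadingCoeff P * r ^ (mo.degree P).degree := by
    rw [hsum, coeff_sum, Finset.sum_eq_single (mo.degree P)]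
    · rw [coeff_C_mul, ← (hm (mo.degree P)).2, MonomialOrder.leadingCoeff,
        MonomialOrder.leadingCoeff, (hm (mo.degree P)).1]
    · intro d hd hne
      rw [coeff_C_mul, mo.coeff_eq_zero_of_lt (f := T (monomial d 1)), mul_zero]
      rw [(hm d).1]
      exact lt_of_le_of_ne (mo.le_degree hd) fun h => hne (mo.toSyn.injective h)
    · intro h
      exact absurd (mo.degree_mem_support hP) h
  have hle : mo.degree (T P) ≼[mo] mo.degree P := by
    rw [mo.degree_le_iff]
    intro e he
    by_contra hlt
    rw [not_le] at hlt
    rw [mem_support_iff] at he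
    apply he
    rw [hsum, coeff_sum]
    refine Finset.sum_eq_zero fun d hd => ?_
    rw [coeff_C_mul, mo.coeff_eq_zero_of_lt (f := T (monomial d 1)), mul_zero]
    rw [(hm d).1]
    exact (mo.le_degree hd).trans_lt hlt
  have hdeg : mo.degree (T P) = mo.degree P := by
    refine mo.toSyn.injective (le_antisymm hle (mo.le_degree ?_))
    rw [mem_support_iff, hcoeff]
    exact mul_ne_zero (mo.leadingCoeff_ne_zero_iff.2 hP) (pow_ne_zero _ hr)
  exact ⟨hdeg, by rw [MonomialOrder.leadingCoeff, hdeg, hcoeff]⟩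

theorem aeval_triangular_injective (hr : r ≠ 0)
    (hg : ∀ i, mo.degree (g i) ≺[mo] Finsupp.single i 1) :
    Function.Injective (aeval (R := R) (fun i => C r * X i + g i)) := by
  rw [injective_iff_map_eq_zero]
  intro P hP
  by_contra hne
  have h := (degree_aeval_triangular mo hr hg hne).2
  rw [hP, mo.leadingCoeff_zero] at h
  exact mul_ne_zero (mo.leadingCoeff_ne_zero_iff.2 hne) (pow_ne_zero _ hr) h.symm

end LeadingTerm

/-! ### Elements of minimal degree of an ideal of polynomials -/

section MinimalDegree

open MvPolynomial
open scoped MonomialOrder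
variable {ι R : Type*} [CommRing R] [IsPrincipalIdealRing R] (mo : MonomialOrder ι)

/-- Over a principal ideal ring, the elements of minimal degree of a nonzero ideal `I` are the
constant multiples of one of them: the leading coefficients of these elements form an ideal. -/
theorem exists_forall_eq_C_mul_of_degree_le {I : Ideal (MvPolynomial ι R)} (hI : I ≠ ⊥) :
    ∃ P ∈ I, P ≠ 0 ∧ ∀ Q ∈ I, mo.degree Q ≼[mo] mo.degree P → ∃ q : R, Q = C q * P := by
  obtain ⟨P₀, ⟨hP₀I, hP₀⟩, hmin⟩ := WellFounded.has_min
    (InvImage.wf (fun P : MvPolynomial ι R => mo.toSyn (mo.degree P)) wellFounded_lt)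
    {P | P ∈ I ∧ P ≠ 0} ((Submodule.ne_bot_iff I).1 hI)
  set m := mo.degree P₀ with hm
  let J : Ideal R :=
    { carrier := {a | ∃ Q ∈ I, mo.degree Q ≼[mo] m ∧ Q.coeff m = a}
      add_mem' := by
        rintro _ _ ⟨Q, hQ, hQm, rfl⟩ ⟨Q', hQ', hQm', rfl⟩
        exact ⟨Q + Q', I.add_mem hQ hQ', mo.degree_add_le.trans (sup_le hQm hQm'), by simp⟩
      zero_mem' := ⟨0, I.zero_mem, by simp, by simp⟩
      smul_mem' := by
        rintro c _ ⟨Q, hQ, hQm, rfl⟩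
        exact ⟨c • Q, Submodule.smul_of_tower_mem I c hQ, mo.degree_smul_le.trans hQm, by simp⟩ }
  obtain ⟨a, ha⟩ := IsPrincipalIdealRing.principal J
  have haJ : a ∈ J := by rw [ha]; exact Submodule.mem_span_singleton_self a
  obtain ⟨P, hPI, hPm, hPa⟩ := haJ
  have hdvd : ∀ Q ∈ I, mo.degree Q ≼[mo] m → ∃ q : R, Q = C q * P := by
    intro Q hQ hQm
    have hQJ : Q.coeff m ∈ J := ⟨Q, hQ, hQm, rfl⟩
    rw [ha] at hQJ
    obtain ⟨q, hq⟩ := Submodule.mem_span_singleton.1 hQJ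
    refine ⟨q, sub_eq_zero.1 ?_⟩
    by_contra hne
    have hmem : Q - C q * P ∈ I := I.sub_mem hQ (I.mul_mem_left _ hPI)
    have hle : mo.degree (Q - C q * P) ≼[mo] m := by
      rw [C_mul']
      exact mo.degree_sub_le.trans (sup_le hQm (mo.degree_smul_le.trans hPm))
    have heq : mo.degree (Q - C q * P) = m :=
      mo.toSyn.injective (hle.eq_of_not_lt (hmin _ ⟨hmem, hne⟩))
    have hc := mo.coeff_degree_ne_zero_iff.2 hne
    rw [heq, coeff_sub, coeff_C_mul, hPa, ← smul_eq_mul, hq, sub_self] at hc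
    exact hc rfl
  have hP : P ≠ 0 := by
    rintro rfl
    obtain ⟨q, hq⟩ := hdvd P₀ hP₀I le_rfl
    exact hP₀ (by rw [hq, mul_zero])
  have hPdeg : mo.degree P = m :=
    mo.toSyn.injective (hPm.eq_of_not_lt (hmin _ ⟨hPI, hP⟩))
  exact ⟨P, hPI, hP, fun Q hQ h => hdvd Q hQ (hPdeg ▸ h)⟩

end MinimalDegree

/-! ### The substitutions `Y n ↦ r Y n + c n Y (n - 1)` and `Y 0 ↦ 0` -/

section ShiftVars

open MvPolynomial
variable {R S : Type*} [CommRing R] [CommRing S]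

/-- The lexicographic order on monomials in `Y 0, Y 1, …` for which `Y n` exceeds every monomial
in `Y 0, …, Y (n - 1)`; Mathlib's `MonomialOrder.lex` gives the smallest index the most weight,
whence the order dual. -/
noncomputable def revLex : MonomialOrder ℕ := (MonomialOrder.lex : MonomialOrder ℕᵒᵈ)

theorem revLex_single_lt_single {m n : ℕ} (h : m < n) :
    revLex.toSyn (Finsupp.single m 1) < revLex.toSyn (Finsupp.single n 1) :=
  (MonomialOrder.lex_lt_iff (σ := ℕᵒᵈ)).2
    (Finsupp.Lex.single_strictAnti (α := ℕᵒᵈ) (OrderDual.toDual_lt_toDual.2 h))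

/-- The substitution `Y n ↦ r Y n + c n Y (n - 1)`. It is used for `c 0 = 0` only, so that the
truncated subtraction does not matter. -/
noncomputable def shiftVars (r : R) (c : ℕ → R) : MvPolynomial ℕ R →ₐ[R] MvPolynomial ℕ R :=
  aeval fun n => C r * X n + C (c n) * X (n - 1)

@[simp]
theorem shiftVars_X (r : R) (c : ℕ → R) (n : ℕ) :
    shiftVars r c (X n) = C r * X n + C (c n) * X (n - 1) := aeval_X _ _

@[simp]
theorem shiftVars_C (r : R) (c : ℕ → R) (a : R) : shiftVars r c (C a) = C a :=
  (shiftVars r c).commutes a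

theorem degree_C_mul_X_lt_single {c : ℕ → R} (hc : c 0 = 0) (n : ℕ) :
    revLex.toSyn (revLex.degree (C (c n) * X (n - 1) : MvPolynomial ℕ R)) <
      revLex.toSyn (Finsupp.single n 1) := by
  rcases Nat.eq_zero_or_pos n with rfl | h
  · rw [hc, C_0, zero_mul, MonomialOrder.degree_zero, map_zero, MonomialOrder.toSyn_lt_iff_ne_zero,
      Ne, MonomialOrder.toSyn_eq_zero_iff]
    simp
  · rw [C_mul']
    exact (MonomialOrder.degree_smul_le.trans MonomialOrder.degree_X_le_single).trans_lt
      (revLex_single_lt_single (Nat.sub_lt h one_pos))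

theorem map_shiftVars (f : R →+* S) (r : R) (c : ℕ → R) (P : MvPolynomial ℕ R) :
    map f (shiftVars r c P) = shiftVars (f r) (fun n => f (c n)) (map f P) := by
  induction P using MvPolynomial.induction_on with
  | C a => rw [shiftVars_C, map_C, shiftVars_C]
  | add p q hp hq => simp only [map_add, hp, hq]
  | mul_X p n hp => simp only [map_mul, hp, shiftVars_X, map_add, map_C, map_X]

theorem shiftVars_injective [IsDomain R] {r : R} (hr : r ≠ 0) {c : ℕ → R} (hc : c 0 = 0) :
    Function.Injective (shiftVars r c) :=
  aeval_triangular_injective revLex hr (degree_C_mul_X_lt_single hc)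

/-- The substitution `Y 0 ↦ 0`. -/
noncomputable def killZero (R : Type*) [CommRing R] : MvPolynomial ℕ R →ₐ[R] MvPolynomial ℕ R :=
  aeval fun n => if n = 0 then 0 else X n

@[simp]
theorem killZero_C (a : R) : killZero R (C a) = C a := (killZero R).commutes a

@[simp]
theorem killZero_X (n : ℕ) : killZero R (X n) = if n = 0 then 0 else X n := aeval_X _ _

theorem map_killZero (f : R →+* S) (P : MvPolynomial ℕ R) :
    map f (killZero R P) = killZero S (map f P) := by
  induction P using MvPolynomial.induction_on with
  | C a => rw [killZero_C, map_C, killZero_C]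
  | add p q hp hq => simp only [map_add, hp, hq]
  | mul_X p n hp =>
    simp only [map_mul, hp, killZero_X, map_X]
    by_cases h : n = 0 <;> simp [h]

theorem X_zero_dvd_of_killZero_eq_zero {P : MvPolynomial ℕ R} (h : killZero R P = 0) :
    X 0 ∣ P := by
  set I : Ideal (MvPolynomial ℕ R) := Ideal.span {X 0} with hI
  have hX : Ideal.Quotient.mk I (X 0) = 0 :=
    Ideal.Quotient.eq_zero_iff_mem.2 (Ideal.mem_span_singleton_self _)
  have hcomp : (Ideal.Quotient.mkₐ R I).comp (killZero R) = Ideal.Quotient.mkₐ R I := by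
    refine algHom_ext fun n => ?_
    rw [AlgHom.comp_apply, killZero_X]
    split_ifs with hn
    · rw [hn, map_zero]; exact hX.symm
    · rfl
  have := DFunLike.congr_fun hcomp P
  rw [AlgHom.comp_apply, h, map_zero] at this
  exact Ideal.mem_span_singleton.1 (Ideal.Quotient.eq_zero_iff_mem.1 this.symm)

theorem killZero_shiftVars (r : R) {c : ℕ → R} (hc : c 0 = 0) (P : MvPolynomial ℕ R) :
    killZero R (shiftVars r c P) =
      shiftVars r (fun n => if n ≤ 1 then 0 else c n) (killZero R P) := by
  refine DFunLike.congr_fun (?_ : (killZero R).comp (shiftVars r c) =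
    (shiftVars r fun n => if n ≤ 1 then 0 else c n).comp (killZero R)) P
  refine algHom_ext fun n => ?_
  rcases n with _ | _ | n
  · simp only [AlgHom.comp_apply, shiftVars_X, killZero_X, map_add, map_mul, killZero_C, hc]
    simp
  · simp only [AlgHom.comp_apply, shiftVars_X, killZero_X, map_add, map_mul, killZero_C]
    simp
  · simp only [AlgHom.comp_apply, shiftVars_X, killZero_X, map_add, map_mul, killZero_C]
    simp

/-- For `r = 0` and `c n = n` the substitution has the left inverse `Y n ↦ Y (n + 1) / (n + 1)` on
polynomials in which `Y 0` is set to `0`. -/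
theorem killZero_eq_zero_of_shiftVars_zero {F : Type*} [Field F] [CharZero F]
    {P : MvPolynomial ℕ F} (h : shiftVars 0 (fun n => (n : F)) P = 0) : killZero F P = 0 := by
  have hcomp : (aeval fun n : ℕ => C ((n + 1 : F)⁻¹) * X (n + 1)).comp
      (shiftVars 0 fun n => (n : F)) = killZero F := by
    refine algHom_ext fun n => ?_
    rw [AlgHom.comp_apply, shiftVars_X, killZero_X]
    rcases n with _ | n
    · simp
    · have hn : (n + 1 : F) ≠ 0 := by exact_mod_cast n.succ_ne_zero
      rw [C_0, zero_mul, zero_add, map_mul, algHom_C, Nat.add_sub_cancel, aeval_X,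
        algebraMap_eq, ← mul_assoc, ← C_mul, Nat.cast_succ, mul_inv_cancel₀ hn, C_1, one_mul,
        if_neg n.succ_ne_zero]
  rw [← hcomp, AlgHom.comp_apply, h, map_zero]

end ShiftVars

/-! ### Hölder's theorem, algebraically -/

section Hoelder
open Polynomial (taylorAlgHom)
open MvPolynomial

variable {F E : Type*} [Field F] [Field E] [Algebra F E]

/-- Evaluation of a polynomial in `Y 0, Y 1, …` over `F[X]` at `X = x` and `Y n = y n`. -/
noncomputable def evalRel (x : E) (y : ℕ → E) : MvPolynomial ℕ (Polynomial F) →+* E :=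
  eval₂Hom (Polynomial.aeval (R := F) x).toRingHom y

/-- The operator on polynomials over `F[X]` that corresponds to an endomorphism `σ` with
`σ x = x + 1` and `σ (y n) = x y n + n y (n - 1)`. -/
noncomputable def shiftRel : MvPolynomial ℕ (Polynomial F) →+* MvPolynomial ℕ (Polynomial F) :=
  (shiftVars Polynomial.X fun n => (n : Polynomial F)).toRingHom.comp
    (map (taylorAlgHom (1 : F)).toRingHom)

theorem shiftRel_apply (P : MvPolynomial ℕ (Polynomial F)) : shiftRel P =
    shiftVars Polynomial.X (fun n => (n : Polynomial F)) (map (taylorAlgHom (1 : F)).toRingHom P) :=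
  rfl

theorem evalRel_shiftRel {x : E} {y : ℕ → E} (σ : E →ₐ[F] E) (hx : σ x = x + 1)
    (hy : ∀ n, σ (y n) = x * y n + n * y (n - 1)) (P : MvPolynomial ℕ (Polynomial F)) :
    evalRel x y (shiftRel P) = σ (evalRel x y P) := by
  refine RingHom.congr_fun (f := (evalRel x y).comp shiftRel)
    (g := (σ : E →+* E).comp (evalRel x y)) ?_ P
  refine MvPolynomial.ringHom_ext (fun p => ?_) fun n => ?_
  · simp only [RingHom.comp_apply, shiftRel_apply, map_C, shiftVars_C]
    simp only [evalRel, coe_eval₂Hom, eval₂_C]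
    change Polynomial.aeval x (Polynomial.taylor 1 p) = σ (Polynomial.aeval x p)
    rw [Polynomial.taylor_apply, Polynomial.aeval_comp, ← Polynomial.aeval_algHom_apply, hx]
    simp
  · simp only [RingHom.comp_apply, shiftRel_apply, map_X, shiftVars_X]
    simp [evalRel, hy]

theorem degree_map_of_injective {R S : Type*} [CommRing R] [CommRing S] {ι : Type*}
    (mo : MonomialOrder ι) {f : R →+* S} (hf : Function.Injective f) (P : MvPolynomial ι R) :
    mo.degree (map f P) = mo.degree P := by
  rw [MonomialOrder.degree, MonomialOrder.degree, support_map_of_injective _ hf]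

theorem degree_shiftRel {P : MvPolynomial ℕ (Polynomial F)} (hP : P ≠ 0) :
    revLex.degree (shiftRel P) = revLex.degree P ∧ revLex.leadingCoeff (shiftRel P) =
      Polynomial.taylor 1 (revLex.leadingCoeff P) *
        Polynomial.X ^ (revLex.degree P).degree := by
  have hinj : Function.Injective (taylorAlgHom (1 : F)).toRingHom :=
    Polynomial.taylor_injective (1 : F)
  have hP' : map (taylorAlgHom (1 : F)).toRingHom P ≠ 0 := by
    rwa [Ne, map_eq_zero_iff _ (map_injective _ hinj)]
  have h := degree_aeval_triangular revLex Polynomial.X_ne_zero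
    (degree_C_mul_X_lt_single (c := fun n => (n : Polynomial F)) Nat.cast_zero) hP'
  have hlc : revLex.leadingCoeff (map (taylorAlgHom (1 : F)).toRingHom P) =
      Polynomial.taylor 1 (revLex.leadingCoeff P) := by
    rw [MonomialOrder.leadingCoeff, degree_map_of_injective revLex hinj, coeff_map]
    rfl
  rw [hlc, degree_map_of_injective revLex hinj] at h
  exact h

/-- If the shift of `P` is a multiple `q P`, comparing leading coefficients gives the degree
of `q`. -/
theorem natDegree_of_shiftRel_eq {P : MvPolynomial ℕ (Polynomial F)} (hP : P ≠ 0)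
    {q : Polynomial F} (h : shiftRel P = C q * P) :
    q ≠ 0 ∧ q.natDegree = (revLex.degree P).degree := by
  obtain ⟨h1, h2⟩ := degree_shiftRel hP
  rw [MonomialOrder.leadingCoeff, h1, h, coeff_C_mul] at h2
  have ha : revLex.leadingCoeff P ≠ 0 := revLex.leadingCoeff_ne_zero_iff.2 hP
  change q * revLex.leadingCoeff P = _ at h2
  have ha' : Polynomial.taylor 1 (revLex.leadingCoeff P) ≠ 0 := by
    rwa [Ne, Polynomial.taylor_eq_zero]
  have hX : (Polynomial.X : Polynomial F) ^ (revLex.degree P).degree ≠ 0 :=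
    pow_ne_zero _ Polynomial.X_ne_zero
  have hq : q ≠ 0 := by
    rintro rfl
    rw [zero_mul] at h2
    exact mul_ne_zero ha' hX h2.symm
  refine ⟨hq, ?_⟩
  have h3 := congrArg Polynomial.natDegree h2
  rw [Polynomial.natDegree_mul hq ha, Polynomial.natDegree_mul ha' hX,
    Polynomial.natDegree_taylor, Polynomial.natDegree_X_pow] at h3
  omega

/-- Modulo an irreducible polynomial other than `X` the substitution in the shift is invertible, so
that a common factor of the shift of `P` comes from a common factor of `P`. -/
theorem exists_C_mul_of_C_dvd_shiftRel {P : MvPolynomial ℕ (Polynomial F)} {p : Polynomial F}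
    (hp : Irreducible p) (hpX : ¬ p ∣ Polynomial.X) (h : C p ∣ shiftRel P) :
    ∃ p' : Polynomial F, Irreducible p' ∧ C p' ∣ P := by
  have hprime : (Ideal.span {p}).IsPrime := by
    rw [Ideal.span_singleton_prime hp.ne_zero]; exact hp.prime
  set f := Ideal.Quotient.mk (Ideal.span {p})
  have hf : ∀ a, f a = 0 ↔ p ∣ a := fun a => by
    rw [Ideal.Quotient.eq_zero_iff_mem, Ideal.mem_span_singleton]
  have h1 : map f (shiftRel P) = 0 := (C_dvd_iff_map_hom_eq_zero f p hf _).1 h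
  rw [shiftRel_apply, map_shiftVars] at h1
  have hX : f Polynomial.X ≠ 0 := fun h => hpX ((hf _).1 h)
  have h2 := (injective_iff_map_eq_zero _).1
    (shiftVars_injective hX (c := fun n => f (n : Polynomial F)) (by simp)) _ h1
  rw [← C_dvd_iff_map_hom_eq_zero f p hf, C_dvd_iff_dvd_coeff] at h2
  set e := Polynomial.taylorEquiv (1 : F)
  refine ⟨e.symm p, (MulEquiv.irreducible_iff e.symm).2 hp,
    (C_dvd_iff_dvd_coeff _ _).2 fun i => ?_⟩
  obtain ⟨b, hb⟩ := h2 i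
  rw [coeff_map] at hb
  have hb' : e (P.coeff i) = p * b := hb
  refine ⟨e.symm b, ?_⟩
  rw [← map_mul, ← hb', AlgEquiv.symm_apply_apply]

variable [CharZero F]

/-- If the shift of `P` is `q P` and `q` vanishes at `0`, then `P` vanishes at `X = k`, `Y 0 = 0`
for every positive integer `k`, by induction on `k`. -/
theorem X_zero_dvd_of_shiftRel_eq {P : MvPolynomial ℕ (Polynomial F)}
    {q : Polynomial F} (h : shiftRel P = C q * P) (hq : q.eval 0 = 0) : X 0 ∣ P := by
  set ev : ℕ → Polynomial F →+* F := fun k => Polynomial.evalRingHom (k : F) with hev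
  have hshift : ∀ k : ℕ, shiftVars (k : F) (fun n => (n : F)) (map (ev (k + 1)) P) =
      C (q.eval (k : F)) * map (ev k) P := fun k => by
    have h1 := congrArg (map (ev k)) h
    rw [shiftRel_apply, map_shiftVars, map_map, map_mul, map_C] at h1
    have h2 : (ev k).comp (taylorAlgHom (1 : F)).toRingHom = ev (k + 1) := by
      ext <;> simp [hev]
    rw [h2] at h1
    simpa [hev] using h1
  have hkill : ∀ k : ℕ, killZero F (map (ev (k + 1)) P) = 0 := by
    intro k
    induction k with
    | zero =>
      refine killZero_eq_zero_of_shiftVars_zero ?_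
      have := hshift 0
      rwa [Nat.cast_zero, hq, C_0, zero_mul] at this
    | succ k ih =>
      have h1 := congrArg (killZero F) (hshift (k + 1))
      rw [killZero_shiftVars _ (by simp), map_mul, ih, mul_zero] at h1
      exact (injective_iff_map_eq_zero _).1
        (shiftVars_injective (Nat.cast_ne_zero.2 k.succ_ne_zero) (by simp)) _ h1
  refine X_zero_dvd_of_killZero_eq_zero (MvPolynomial.ext _ _ fun i => ?_)
  rw [coeff_zero]
  refine Polynomial.eq_zero_of_infinite_isRoot _ ?_
  refine Set.infinite_of_injective_forall_mem (f := fun k : ℕ => ((k + 1 : ℕ) : F))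
    (fun a b hab => by simpa using hab) fun k => ?_
  have h1 := hkill k
  rw [← map_killZero] at h1
  have h2 := congrArg (coeff i) h1
  rw [coeff_map, coeff_zero] at h2
  exact h2

/-- The algebraic form of Hölder's theorem: a sequence with `y 0 ≠ 0` transforming under `σ` like
the derivatives of the Gamma function under `x ↦ x + 1` is algebraically independent, together with
`x`, over the field of constants. -/
theorem algebraicIndependent_of_shift {x : E} {y : ℕ → E} (σ : E →ₐ[F] E)
    (hxt : Transcendental F x) (hx : σ x = x + 1) (hy0 : y 0 ≠ 0)
    (hy : ∀ n, σ (y n) = x * y n + n * y (n - 1)) :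
    AlgebraicIndependent F (Sum.elim y fun _ : Unit => x) := by
  have hC : ∀ p : Polynomial F, evalRel x y (C p) = Polynomial.aeval x p := fun p => by
    simp [evalRel]
  have haeval : ∀ p : Polynomial F, p ≠ 0 → Polynomial.aeval x p ≠ 0 := fun p hp h =>
    hp (transcendental_iff.1 hxt p h)
  have hker : RingHom.ker (evalRel (F := F) x y) = ⊥ := by
    by_contra hI
    obtain ⟨P, hPI, hP, hmin⟩ := exists_forall_eq_C_mul_of_degree_le revLex hI
    rw [RingHom.mem_ker] at hPI
    -- A factor of `P` lying in the kernel is `P` times a constant, so the cofactor is constant.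
    have hunit : ∀ A Q, P = A * Q → evalRel x y A ≠ 0 → IsUnit A := by
      intro A Q hAQ hA
      have hQ : Q ∈ RingHom.ker (evalRel (F := F) x y) := by
        rw [hAQ, map_mul] at hPI
        exact (mul_eq_zero.1 hPI).resolve_left hA
      have hA0 : A ≠ 0 := by rintro rfl; exact hA (map_zero _)
      have hQ0 : Q ≠ 0 := by rintro rfl; exact hP (by rw [hAQ, mul_zero])
      obtain ⟨q, hq⟩ := hmin Q hQ (by
        rw [hAQ, revLex.degree_mul hA0 hQ0, map_add]
        exact le_add_of_nonneg_left (MonomialOrder.zero_le _ _))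
      refine IsUnit.of_mul_eq_one (C q) ?_
      refine mul_right_cancel₀ hP ?_
      rw [one_mul, mul_assoc, ← hq, ← hAQ]
    have hPτ : evalRel x y (shiftRel P) = 0 := by
      rw [evalRel_shiftRel σ hx hy, hPI, map_zero]
    -- The shift of `P` has the degree of `P`, hence is a multiple `q P`.
    obtain ⟨q, hq⟩ := hmin _ hPτ (by rw [(degree_shiftRel hP).1])
    obtain ⟨hq0, hqdeg⟩ := natDegree_of_shiftRel_eq hP hq
    by_cases hd : q.natDegree = 0
    · have hdeg : revLex.degree P = 0 := by
        rwa [hd, eq_comm, Finsupp.degree_eq_zero_iff] at hqdeg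
      have hPC := revLex.eq_C_of_degree_eq_zero hdeg
      rw [hPC, hC] at hPI
      exact haeval _ (revLex.leadingCoeff_ne_zero_iff.2 hP) hPI
    · have hqu : ¬ IsUnit q := fun h => hd (Polynomial.natDegree_eq_zero_of_isUnit h)
      obtain ⟨p, hp, hpq⟩ := WfDvdMonoid.exists_irreducible_factor hqu hq0
      have hpX : p ∣ Polynomial.X := by
        by_contra hpX
        obtain ⟨p', hp', Q, hQ⟩ := exists_C_mul_of_C_dvd_shiftRel hp hpX
          (hq ▸ (C.map_dvd hpq).mul_right P)
        have := (hunit _ Q hQ (by rw [hC]; exact haeval _ hp'.ne_zero)).map constantCoeff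
        rw [constantCoeff_C] at this
        exact hp'.not_isUnit this
      have hXq : Polynomial.X ∣ q :=
        (hp.dvd_symm Polynomial.irreducible_X hpX).trans hpq
      have hq00 : q.eval 0 = 0 := by
        rwa [Polynomial.X_dvd_iff, Polynomial.coeff_zero_eq_eval_zero] at hXq
      obtain ⟨Q, hQ⟩ := X_zero_dvd_of_shiftRel_eq hq hq00
      have := (hunit _ Q hQ (by simpa [evalRel] using hy0)).map constantCoeff
      rw [constantCoeff_X] at this
      exact not_isUnit_zero this
  let _ : Algebra (Polynomial F) E := (Polynomial.aeval (R := F) x).toRingHom.toAlgebra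
  have : IsScalarTower F (Polynomial F) E :=
    IsScalarTower.of_algebraMap_eq fun a => (Polynomial.aeval_C x a).symm
  have hyA : AlgebraicIndependent (Polynomial F) y := (RingHom.injective_iff_ker_eq_bot _).2 hker
  have hxA : AlgebraicIndependent F fun _ : Unit => x :=
    algebraicIndependent_unique_type_iff.2 hxt
  refine hxA.sumElim_of_tower (S := Polynomial F) ?_ hyA
  rintro _ ⟨_, rfl⟩
  exact ⟨Polynomial.X, Polynomial.aeval_X x⟩

end Hoelder

namespace Mer

open Filter Topology

/-! ### Periodic functions as constants of the shift -/

theorem differentiable_add_one : Differentiable ℂ fun z : ℂ => z + 1 := by fun_prop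

/-- The shift `f(x) ↦ f(x + 1)`. -/
noncomputable def shift : Mer →ₐ[ℂ] Mer :=
  compHom (fun z => z + 1) differentiable_add_one ⟨0, 1, by norm_num⟩

theorem deriv_shift (a : Mer) : Differential.deriv (shift a) = shift (Differential.deriv a) := by
  rw [shift, deriv_compHom]
  have : Differential.deriv (mk (fun z => z + 1)
      (meromorphic_of_differentiable differentiable_add_one)) = 1 := by
    rw [deriv_mk, ← mk_one, mk_eq_mk]
    exact Eventually.of_forall fun z => by simp
  rw [this, mul_one]

theorem shift_X : shift X = X + 1 := rfl

/-- The field of meromorphic functions of period `1`. -/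
noncomputable def periodic : IntermediateField ℂ Mer where
  carrier := {a | shift a = a}
  mul_mem' ha hb := (map_mul shift _ _).trans (congrArg₂ _ ha hb)
  add_mem' ha hb := (map_add shift _ _).trans (congrArg₂ _ ha hb)
  algebraMap_mem' := shift.commutes
  inv_mem' _ ha := (map_inv₀ shift _).trans (congrArg _ ha)

theorem mem_periodic {a : Mer} : a ∈ periodic ↔ shift a = a := Iff.rfl

theorem deriv_mem_periodic (a : Mer) (ha : a ∈ periodic) : Differential.deriv a ∈ periodic := by
  rw [mem_periodic, ← deriv_shift, mem_periodic.1 ha]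

/-- The shift is linear over the field of periodic functions. -/
noncomputable def shiftPeriodic : Mer →ₐ[periodic] Mer where
  toRingHom := (shift : Mer →+* Mer)
  commutes' c := c.2

theorem shiftPeriodic_apply (a : Mer) : shiftPeriodic a = shift a := rfl

/-- If a polynomial with periodic coefficients that vanishes at `x`, it vanishes at `x + n` for all
`n`. -/
theorem transcendental_X : Transcendental periodic X := by
  rw [transcendental_iff]
  intro p hp
  have hroot : ∀ n : ℕ, Polynomial.aeval (X + (n : Mer)) p = 0 := by
    intro n
    induction n with
    | zero => simpa using hp
    | succ n ih =>
      have h1 := congrArg shiftPeriodic ih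
      rw [← Polynomial.aeval_algHom_apply, map_zero, map_add, map_natCast, shiftPeriodic_apply,
        shift_X] at h1
      rwa [Nat.cast_succ, add_comm (n : Mer), ← add_assoc]
  rw [← Polynomial.map_eq_zero (algebraMap periodic Mer)]
  refine Polynomial.eq_zero_of_infinite_isRoot _ ?_
  refine Set.infinite_of_injective_forall_mem (f := fun n : ℕ => X + (n : Mer))
    (fun a b hab => ?_) fun n => ?_
  · have : CharZero Mer := charZero_of_injective_algebraMap (algebraMap ℂ Mer).injective
    simpa using hab
  · rw [Set.mem_ofPred_eq, Polynomial.IsRoot.def, Polynomial.eval_map_algebraMap, hroot]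

/-! ### The Gamma function -/

theorem Gamma_ne_zero : Gamma ≠ 0 :=
  mk_ne_zero_of_continuousAt _ (z := 1)
    (Complex.differentiableAt_Gamma_one).continuousAt (by simp)

theorem eventually_ne (c : ℂ) : ∀ᶠ z in codiscrete ℂ, z ≠ c := by
  refine eventually_codiscrete_iff.2 fun x => ?_
  by_cases hx : x = c
  · rw [hx]; exact self_mem_nhdsWithin
  · exact (continuousAt_id.eventually_ne hx).filter_mono nhdsWithin_le_nhds

/-- The functional equation `Γ(x + 1) = x Γ(x)`. -/
theorem shift_Gamma : shift Gamma = X * Gamma := by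
  refine Subtype.ext (Germ.coe_eq.2 ?_)
  filter_upwards [eventually_ne 0] with z hz
  exact Complex.Gamma_add_one z hz

theorem shift_iterate_deriv_Gamma (n : ℕ) :
    shift ((Differential.deriv : Mer → Mer)^[n] Gamma) =
      X * (Differential.deriv : Mer → Mer)^[n] Gamma +
        n * (Differential.deriv : Mer → Mer)^[n - 1] Gamma := by
  induction n with
  | zero => simp [shift_Gamma]
  | succ n ih =>
    rw [Function.iterate_succ_apply', ← deriv_shift, ih]
    rcases n with _ | n
    · simp [Derivation.leibniz, deriv_X]
    · simp only [map_add, Derivation.leibniz, deriv_X, smul_eq_mul, Nat.add_sub_cancel,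
        Function.iterate_succ_apply', Derivation.map_natCast, Nat.cast_succ,
        Derivation.map_one_eq_zero]
      ring

/-- Hölder's theorem over the field of periodic functions. -/
theorem algebraicIndependent_Gamma_X : AlgebraicIndependent periodic
    (Sum.elim (fun n => (Differential.deriv : Mer → Mer)^[n] Gamma) fun _ : Unit => X) :=
  algebraicIndependent_of_shift shiftPeriodic transcendental_X shift_X Gamma_ne_zero
    shift_iterate_deriv_Gamma

theorem not_isDifferentiallyAlgebraic_Gamma : ¬ IsDifferentiallyAlgebraic ℂ Gamma := by
  intro h
  have h1 : AlgebraicIndependent periodic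
      fun n => (Differential.deriv : Mer → Mer)^[n] Gamma :=
    algebraicIndependent_Gamma_X.comp Sum.inl Sum.inl_injective
  exact h.not_algebraicIndependent (h1.restrictScalars (algebraMap ℂ periodic).injective)

/-! ### Elementary differentially algebraic functions -/

theorem isDifferentiallyAlgebraic_algebraMap (c : ℂ) :
    IsDifferentiallyAlgebraic ℂ (algebraMap ℂ Mer c) :=
  IsDifferentiallyAlgebraic.of_mem_finite deriv_algebraMap Set.finite_empty (by simp)
    (IntermediateField.algebraMap_mem _ c)

/-- The function `x ↦ exp (a x)`. -/
noncomputable def expMul (a : ℂ) : Mer :=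
  mk (fun z => Complex.exp (a * z)) (meromorphic_of_differentiable (by fun_prop))

/-- The function `x ↦ sin (a x)`. -/
noncomputable def sinMul (a : ℂ) : Mer :=
  mk (fun z => Complex.sin (a * z)) (meromorphic_of_differentiable (by fun_prop))

/-- The function `x ↦ cos (a x)`. -/
noncomputable def cosMul (a : ℂ) : Mer :=
  mk (fun z => Complex.cos (a * z)) (meromorphic_of_differentiable (by fun_prop))

theorem deriv_expMul (a : ℂ) : Differential.deriv (expMul a) = algebraMap ℂ Mer a * expMul a := by
  refine Subtype.ext (Germ.coe_eq.2 (Eventually.of_forall fun z => ?_))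
  have h := ((hasDerivAt_id z).const_mul a).cexp.deriv
  simpa [mul_comm] using h

theorem deriv_sinMul (a : ℂ) : Differential.deriv (sinMul a) = algebraMap ℂ Mer a * cosMul a := by
  refine Subtype.ext (Germ.coe_eq.2 (Eventually.of_forall fun z => ?_))
  have h := ((hasDerivAt_id z).const_mul a).csin.deriv
  simpa [mul_comm] using h

theorem deriv_cosMul (a : ℂ) :
    Differential.deriv (cosMul a) = -(algebraMap ℂ Mer a * sinMul a) := by
  refine Subtype.ext (Germ.coe_eq.2 (Eventually.of_forall fun z => ?_))
  have h := ((hasDerivAt_id z).const_mul a).ccos.deriv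
  simpa [mul_comm] using h

theorem cosMul_ne_zero (a : ℂ) : cosMul a ≠ 0 :=
  mk_ne_zero_of_continuousAt _ (z := 0) (by fun_prop) (by simp)

theorem expMul_ne_zero (a : ℂ) : expMul a ≠ 0 :=
  mk_ne_zero_of_continuousAt _ (z := 0) (by fun_prop) (by simp)

theorem isDifferentiallyAlgebraic_expMul (a : ℂ) : IsDifferentiallyAlgebraic ℂ (expMul a) := by
  refine IsDifferentiallyAlgebraic.of_mem_finite (S := {expMul a}) deriv_algebraMap
    (Set.finite_singleton _) ?_ (IntermediateField.mem_adjoin_simple_self ℂ _)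
  rintro _ rfl
  rw [deriv_expMul]
  exact mul_mem (IntermediateField.algebraMap_mem _ a)
    (IntermediateField.mem_adjoin_simple_self ℂ _)

theorem isDifferentiallyAlgebraic_cosMul (a : ℂ) : IsDifferentiallyAlgebraic ℂ (cosMul a) := by
  have hs : sinMul a ∈ IntermediateField.adjoin ℂ {sinMul a, cosMul a} :=
    IntermediateField.subset_adjoin _ _ (by simp)
  have hc : cosMul a ∈ IntermediateField.adjoin ℂ {sinMul a, cosMul a} :=
    IntermediateField.subset_adjoin _ _ (by simp)
  refine IsDifferentiallyAlgebraic.of_mem_finite deriv_algebraMap (Set.toFinite _) ?_ hc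
  rintro _ (rfl | rfl)
  · rw [deriv_sinMul]
    exact mul_mem (IntermediateField.algebraMap_mem _ a) hc
  · rw [deriv_cosMul]
    exact neg_mem (mul_mem (IntermediateField.algebraMap_mem _ a) hs)

/-! ### The zeta function -/

/-- The Riemann zeta function, as a meromorphic function on `ℂ`. -/
noncomputable def zeta : Mer := mk riemannZeta meromorphic_riemannZeta

theorem zeta_ne_zero : zeta ≠ 0 :=
  mk_ne_zero_of_continuousAt _ (z := 2)
    (differentiableAt_riemannZeta (by norm_num)).continuousAt
    (riemannZeta_ne_zero_of_one_le_re (by norm_num))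

theorem differentiable_one_sub : Differentiable ℂ fun z : ℂ => 1 - z := by fun_prop

/-- The reflection `f(x) ↦ f(1 - x)`. -/
noncomputable def reflect : Mer →ₐ[ℂ] Mer :=
  compHom (fun z => 1 - z) differentiable_one_sub ⟨0, 1, by norm_num⟩

theorem deriv_reflect (a : Mer) :
    Differential.deriv (reflect a) = reflect (Differential.deriv a) * (-1) := by
  rw [reflect, deriv_compHom]
  congr 1
  rw [deriv_mk, ← mk_one]
  exact Subtype.ext (Germ.coe_eq.2 (Eventually.of_forall fun z => by simp))

theorem reflect_reflect (a : Mer) : reflect (reflect a) = a := by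
  induction a using ind with | h f hf
  exact Subtype.ext (Germ.coe_eq.2 (Eventually.of_forall fun z => by simp))

/-- The functional equation of the zeta function. -/
theorem reflect_zeta : reflect zeta = algebraMap ℂ Mer 2 * expMul (-Complex.log (2 * Real.pi)) *
    Gamma * cosMul (Real.pi / 2) * zeta := by
  refine Subtype.ext (Germ.coe_eq.2 ?_)
  -- The Gamma function of Mathlib takes the value `0` at its poles, where the equation may fail.
  have hpole : ∀ᶠ z in codiscrete ℂ, Complex.Gamma z ≠ 0 :=
    (eventually_eq_zero_or_ne_zero Meromorphic.Gamma).resolve_left fun h =>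
      Gamma_ne_zero (Subtype.ext (Germ.coe_eq.2 h))
  filter_upwards [eventually_ne 1, hpole] with z hz1 hz
  have h := riemannZeta_one_sub (s := z)
    (fun n hn => hz (by rw [hn, Complex.Gamma_neg_nat_eq_zero])) hz1
  have hpi : (2 * Real.pi : ℂ) ≠ 0 := by simp [Real.pi_ne_zero]
  rw [Complex.cpow_def_of_ne_zero hpi, mul_neg, ← neg_mul, mul_div_right_comm] at h
  exact h

/-- If `ζ` were differentially algebraic, then so would be `ζ(1 - x)` and, by the functional
equation, the Gamma function. -/
theorem not_isDifferentiallyAlgebraic_zeta : ¬ IsDifferentiallyAlgebraic ℂ zeta := by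
  intro h
  have hr : IsDifferentiallyAlgebraic ℂ (reflect zeta) := by
    refine IsDifferentiallyAlgebraic.of_map deriv_algebraMap reflect (w := -1) (by simp)
      deriv_reflect ?_ (by rwa [reflect_reflect])
    simpa using isDifferentiallyAlgebraic_algebraMap (-1)
  refine not_isDifferentiallyAlgebraic_Gamma ?_
  have hG : Gamma = reflect zeta * (algebraMap ℂ Mer 2 * expMul (-Complex.log (2 * Real.pi)) *
      cosMul (Real.pi / 2) * zeta)⁻¹ := by
    have h2 : algebraMap ℂ Mer 2 ≠ 0 := by simp
    refine (eq_mul_inv_iff_mul_eq₀ (mul_ne_zero (mul_ne_zero (mul_ne_zero h2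
      (expMul_ne_zero _)) (cosMul_ne_zero _)) zeta_ne_zero)).2 ?_
    rw [reflect_zeta]
    ring
  rw [hG]
  exact hr.mul deriv_algebraMap ((((isDifferentiallyAlgebraic_algebraMap 2).mul deriv_algebraMap
    (isDifferentiallyAlgebraic_expMul _)).mul deriv_algebraMap
    (isDifferentiallyAlgebraic_cosMul _)).mul deriv_algebraMap h).inv

/-! ### Composition with the sine -/

theorem differentiable_sin_two_pi :
    Differentiable ℂ fun z : ℂ => Complex.sin (2 * Real.pi * z) := by fun_prop

/-- The operator `f(x) ↦ f(sin 2πx)`. -/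
noncomputable def compSin : Mer →ₐ[ℂ] Mer :=
  compHom (fun z => Complex.sin (2 * Real.pi * z)) differentiable_sin_two_pi
    ⟨0, 1 / 4, by
      rw [show (2 * Real.pi * (1 / 4) : ℂ) = Real.pi / 2 by ring, Complex.sin_pi_div_two]
      simp⟩

theorem shift_compSin (a : Mer) : shift (compSin a) = compSin a := by
  induction a using ind with | h f hf
  refine Subtype.ext (Germ.coe_eq.2 (Eventually.of_forall fun z => ?_))
  change f (Complex.sin (2 * Real.pi * (z + 1))) = f (Complex.sin (2 * Real.pi * z))
  rw [mul_add, mul_one, Complex.sin_add_two_pi]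

/-- The chain rule for `sin 2πx` has the factor `2π cos 2πx`, which is differentially
algebraic. -/
theorem not_isDifferentiallyAlgebraic_compSin {a : Mer} (ha : ¬ IsDifferentiallyAlgebraic ℂ a) :
    ¬ IsDifferentiallyAlgebraic ℂ (compSin a) := by
  intro h
  have hderiv : Differential.deriv (sinMul (2 * Real.pi)) ≠ 0 := by
    rw [deriv_sinMul]
    refine mul_ne_zero ?_ (cosMul_ne_zero _)
    simp [Real.pi_ne_zero]
  refine ha (IsDifferentiallyAlgebraic.of_map deriv_algebraMap compSin hderiv
    (deriv_compHom _ _) ?_ h)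
  rw [deriv_sinMul]
  exact (isDifferentiallyAlgebraic_algebraMap _).mul deriv_algebraMap
    (isDifferentiallyAlgebraic_cosMul _)

open scoped IntermediateField.algebraAdjoinAdjoin in
/-- A periodic function that is differentially transcendental over `ℂ` is differentially
independent from the Gamma function over `ℂ(x)`: its derivatives are independent over `ℂ` and
belong to the field of periodic functions, over which `x` and the derivatives of the Gamma
function are independent. -/
theorem differentiallyIndependent_of_periodic {g : Mer} (hper : g ∈ periodic)
    (hg : ¬ IsDifferentiallyAlgebraic ℂ g) :
    DifferentiallyIndependent rationalFunctions ![g, Gamma] := by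
  have hgi : AlgebraicIndependent ℂ fun n => (Differential.deriv : Mer → Mer)^[n] g := by
    by_contra h
    exact hg (.of_not_algebraicIndependent deriv_algebraMap h)
  have hgp : AlgebraicIndependent ℂ fun n =>
      (⟨_, iterate_deriv_mem deriv_mem_periodic hper n⟩ : periodic) :=
    AlgebraicIndependent.of_comp periodic.val hgi
  -- Both families become independent over `ℂ` along the tower `ℂ ⊆ periodic ⊆ Mer`; `u` then moves
  -- `x` to the end, so that it can pass into the base field.
  have hall := hgp.sumElim_comp algebraicIndependent_Gamma_X
  let u : (Fin 2 × ℕ) ⊕ Unit → (ℕ ⊕ Unit) ⊕ ℕ :=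
    Sum.elim (fun p => if p.1 = 0 then .inr p.2 else .inl (.inl p.2)) fun t => .inl (.inr t)
  have hu : Function.Injective u := by
    rintro (⟨i, m⟩ | s) (⟨j, n⟩ | t) h
    · fin_cases i <;> fin_cases j <;> simp_all [u]
    · fin_cases i <;> simp [u] at h
    · fin_cases j <;> simp [u] at h
    · rfl
  have hcomp : AlgebraicIndependent ℂ
      (Sum.elim (Sum.elim (fun n => (Differential.deriv : Mer → Mer)^[n] Gamma) fun _ => X)
        (fun n => (Differential.deriv : Mer → Mer)^[n] g) ∘ u) := hall.comp u hu
  have hfam : (Sum.elim (fun p : Fin 2 × ℕ => (Differential.deriv : Mer → Mer)^[p.2]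
      (![g, Gamma] p.1)) fun _ : Unit => X) =
      Sum.elim (Sum.elim (fun n => (Differential.deriv : Mer → Mer)^[n] Gamma) fun _ => X)
        (fun n => (Differential.deriv : Mer → Mer)^[n] g) ∘ u := by
    funext t
    rcases t with ⟨i, n⟩ | t
    · fin_cases i <;> rfl
    · rfl
  rw [← hfam, AlgebraicIndependent.sumElim_iff, Set.range_const] at hcomp
  exact hcomp.2.extendScalars (IntermediateField.adjoin ℂ {X})

end Mer

theorem mainTheorem3 :
    DifferentiallyIndependent Mer.rationalFunctions ![Mer.zetaSin, Mer.Gamma] ∧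
    DifferentiallyIndependent Mer.rationalFunctions ![Mer.gammaSin, Mer.Gamma] :=
  ⟨Mer.differentiallyIndependent_of_periodic (g := Mer.compSin Mer.zeta) (Mer.shift_compSin _)
      (Mer.not_isDifferentiallyAlgebraic_compSin Mer.not_isDifferentiallyAlgebraic_zeta),
    Mer.differentiallyIndependent_of_periodic (g := Mer.compSin Mer.Gamma) (Mer.shift_compSin _)
      (Mer.not_isDifferentiallyAlgebraic_compSin Mer.not_isDifferentiallyAlgebraic_Gamma)⟩
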